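/- Let $d\ge 2$ and let $T$ be the $d$-regular rooted tree, with vertex set $\{1,\dots,d\}^*$ (finite words; the children of $v$ are the words $vx$). For $g\in\mathrm{Aut}(T)$ and a vertex $v$, the section $\varphi_v(g)\in\mathrm{Aut}(T)$ is defined by $g\cdot(vw)=(g\cdot v)(\varphi_v(g)\cdot w)$ for all words $w$. For $G\le\mathrm{Aut}(T)$ and a set $V$ of vertices, $\mathrm{Stab}_G(V)$ denotes the pointwise stabilizer; $\mathcal L_n$ is the set of vertices of level $n$; $\mathrm{Rist}_G(v)$ is the subgroup of elements of $G$ acting trivially outside the subtree of descendants of $v$ (including $v$), and $\mathrm{Rist}_G(\mathcal L_n)$ is the subgroup generated by all $\mathrm{Rist}_G(v)$ with $v\in\mathcal L_n$. Let $G\le\mathrm{Aut}(T)$ be a finitely generated group such that: 1. $G$ is *branch*: it acts transitively on every level, every $\mathrm{Rist}_G(v)$ is infinite, and every $\mathrm{Rist}_G(\mathcal L_n)$ has finite index in $G$; 2. $G$ is *strongly self-replicating*: $\varphi_v(\mathrm{Stab}_G(v))\le G$ for every vertex $v$, and $\varphi_v(\mathrm{Stab}_G(\mathcal L_n))=G$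 for every $n$ and every $v\in\mathcal L_n$; 3. $G$ has the *subgroup induction property*: for every finitely generated subgroup $H\le G$ there is a transversal $X$ of $T$ (a set of vertices meeting every infinite ray from the root in exactly one vertex) such that for each $v\in X$ the group $\varphi_v(\mathrm{Stab}_H(X))$ is either trivial or of finite index in $\varphi_v(\mathrm{Stab}_G(v))$; 4. $G$ has the *congruence subgroup property*: every subgroup of finite index of $G$ contains $\mathrm{Stab}_G(\mathcal L_n)$ for some $n$; 5. $\Phi_F(G)\neq 1$, where $\Phi_F(G)$ is the intersection of all maximal subgroups of finite index of $G$. Let $k\in\mathbb N$ and let $H$ be a group commensurable with the direct power $G^k$, that is, some finite-index subgroup of $H$ is isomorphic to some finite-index subgroup of $G^k$. Then every maximal subgroup of $H$ has finite index in $H$. -/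

import Mathlib

namespace RegTree

/-- The vertices of the `d`-regular rooted tree `T`: finite words over `d` letters.
The root is `[]`, the children of `v` are the words `v ++ [x]`, and `v ≤ w` in the
tree order means that `v` is a prefix of `w`. -/
abbrev Vertex (d : ℕ) : Type := List (Fin d)

/-- `Aut(T)`, as the group (under composition) of automorphisms of the tree order. -/
abbrev TreeAut (d : ℕ) : Type :=
  RelIso (fun v w : Vertex d => v <+: w) (fun v w : Vertex d => v <+: w)

variable {d : ℕ}

/-- The set of vertices of level `n`. -/
def level (d n : ℕ) : Set (Vertex d) := {v | v.length = n}

/-- The action of the section of `g` at `v` on vertices: remove the prefix `g v` from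
`g (v ++ w)`. -/
def sectionFun (g : TreeAut d) (v w : Vertex d) : Vertex d :=
  (g (v ++ w)).drop (g v).length

/-- The characteristic property of sections. -/
theorem apply_append (g : TreeAut d) (v w : Vertex d) :
    g (v ++ w) = g v ++ sectionFun g v w := by
  have h : g v <+: g (v ++ w) := g.map_rel_iff.2 (List.prefix_append v w)
  obtain ⟨t, ht⟩ := h
  simp [sectionFun, ← ht]

theorem sectionFun_eq {g : TreeAut d} {v w u : Vertex d} (h : g (v ++ w) = g v ++ u) :
    sectionFun g v w = u := by
  rw [apply_append] at h
  exact List.append_cancel_left h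

/-- The section `φ_v(g)`: the automorphism with `g (v ++ w) = g v ++ φ_v(g) w`. -/
def sec (v : Vertex d) (g : TreeAut d) : TreeAut d where
  toFun := sectionFun g v
  invFun := sectionFun g⁻¹ (g v)
  left_inv w := by
    apply sectionFun_eq
    rw [← apply_append, RelIso.inv_apply_self, RelIso.inv_apply_self]
  right_inv w := by
    apply sectionFun_eq
    have h := apply_append g⁻¹ (g v) w
    rw [RelIso.inv_apply_self] at h
    rw [← h, RelIso.apply_inv_self]
  map_rel_iff' {a b} := by
    change sectionFun g v a <+: sectionFun g v b ↔ a <+: b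
    rw [← List.prefix_append_right_inj (g v), ← apply_append, ← apply_append]
    exact g.map_rel_iff.trans (List.prefix_append_right_inj v)

theorem apply_append_sec (g : TreeAut d) (v w : Vertex d) :
    g (v ++ w) = g v ++ sec v g w :=
  apply_append g v w

/-- The pointwise stabilizer of a set `V` of vertices in `Aut(T)`. The stabilizer of `V` in a
subgroup `G` is `G ⊓ stab V`. -/
def stab (V : Set (Vertex d)) : Subgroup (TreeAut d) where
  carrier := {g | ∀ v ∈ V, g v = v}
  one_mem' _ _ := rfl
  mul_mem' {a b} ha hb v hv := by
    rw [RelIso.mul_apply, hb v hv, ha v hv]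
  inv_mem' {a} ha v hv := by
    have h := RelIso.inv_apply_self a v
    rwa [ha v hv] at h

/-- The homomorphism `φ_v : Stab(v) → Aut(T)`. -/
def secHom (v : Vertex d) : stab ({v} : Set (Vertex d)) →* TreeAut d where
  toFun g := sec v g
  map_one' := RelIso.ext fun w => sectionFun_eq rfl
  map_mul' g h := RelIso.ext fun w => by
    have hg : (g : TreeAut d) v = v := g.2 v rfl
    have hh : (h : TreeAut d) v = v := h.2 v rfl
    apply sectionFun_eq
    simp only [Subgroup.coe_mul, RelIso.mul_apply]
    rw [apply_append_sec, hh, apply_append_sec, hg]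

/-- The subgroup `φ_v(K)` of `Aut(T)`, for a subgroup `K` of `Aut(T)` that fixes `v`
(in general, the image under `φ_v` of the stabilizer of `v` in `K`). -/
def secImage (v : Vertex d) (K : Subgroup (TreeAut d)) : Subgroup (TreeAut d) :=
  (K.subgroupOf (stab {v})).map (secHom v)

/-- The rigid stabilizer of `v` in `G`: the elements of `G` that act trivially outside the
subtree `T_v`. -/
def rist (G : Subgroup (TreeAut d)) (v : Vertex d) : Subgroup (TreeAut d) :=
  G ⊓ stab {w | ¬ v <+: w}

/-- The rigid stabilizer of level `n`: the subgroup generated by the rigid stabilizers of the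
vertices of level `n`. -/
def ristLevel (G : Subgroup (TreeAut d)) (n : ℕ) : Subgroup (TreeAut d) :=
  ⨆ v ∈ level d n, rist G v

/-- Branch groups: transitive on all levels, with infinite rigid stabilizers of vertices, and
with rigid stabilizers of levels of finite index. -/
structure IsBranch (G : Subgroup (TreeAut d)) : Prop where
  transitive : ∀ n, ∀ v ∈ level d n, ∀ w ∈ level d n, ∃ g ∈ G, g v = w
  infinite_rist : ∀ v, Infinite (rist G v)
  finiteIndex_ristLevel : ∀ n, (ristLevel G n).IsFiniteRelIndex G

/-- Self-similar groups: `φ_v(Stab_G(v)) ≤ G` for all vertices `v`. -/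
def IsSelfSimilar (G : Subgroup (TreeAut d)) : Prop :=
  ∀ v, secImage v (G ⊓ stab {v}) ≤ G

/-- Strongly self-replicating groups: self-similar, with `φ_v(Stab_G(level n)) = G` for all
vertices `v` of level `n`. -/
structure IsStronglySelfReplicating (G : Subgroup (TreeAut d)) : Prop where
  selfSimilar : IsSelfSimilar G
  secImage_eq : ∀ n, ∀ v ∈ level d n, secImage v (G ⊓ stab (level d n)) = G

/-- The congruence subgroup property: every subgroup of finite index in `G` contains the
stabilizer in `G` of some level. -/
def HasCongruenceSubgroupProperty (G : Subgroup (TreeAut d)) : Prop :=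
  ∀ K ≤ G, K.IsFiniteRelIndex G → ∃ n, G ⊓ stab (level d n) ≤ K

/-- A transversal: a set of vertices that meets every infinite ray from the root (given by an
infinite word `ξ`, and passing through the finite prefixes of `ξ`) in exactly one vertex. -/
def IsTransversal (X : Set (Vertex d)) : Prop :=
  ∀ ξ : ℕ → Fin d, ∃! v, v ∈ X ∧ ∃ n, v = List.ofFn fun i : Fin n => ξ i

/-- The subgroup induction property: for every finitely generated `H ≤ G` there is a transversal
`X` such that for all `v ∈ X` the subgroup `φ_v(Stab_H(X))` is trivial or of finite index
in `φ_v(Stab_G(v))`. -/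
def HasSubgroupInductionProperty (G : Subgroup (TreeAut d)) : Prop :=
  ∀ H ≤ G, H.FG → ∃ X : Set (Vertex d), IsTransversal X ∧ ∀ v ∈ X,
    secImage v (H ⊓ stab X) = ⊥ ∨
      (secImage v (H ⊓ stab X)).IsFiniteRelIndex (secImage v (G ⊓ stab {v}))

end RegTree

/-- `Φ_F(G)`: the intersection of the maximal subgroups of finite index of `G`. -/
def frattiniFin (G : Type*) [Group G] : Subgroup G :=
  sInf {M : Subgroup G | IsCoatom M ∧ M.FiniteIndex}

/-- Two groups are commensurable if they have isomorphic subgroups of finite index. -/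
def AreCommensurable (A B : Type*) [Group A] [Group B] : Prop :=
  ∃ (K : Subgroup A) (J : Subgroup B), K.FiniteIndex ∧ J.FiniteIndex ∧ Nonempty (K ≃* J)

/-! A maximal subgroup of infinite index is dense in the profinite topology. Density survives
homomorphisms and intersection with subgroups of finite index (`DenseIn.map`, `DenseIn.inf`), so it
suffices that a finite-index subgroup J of G^k has no proper dense subgroup D
(`RegTree.eq_of_denseIn`).

Subgroup induction sees only finitely generated subgroups, so D is shrunk to a finitely generated
dense E. For cyclic subgroups, subgroup induction shows that G is torsion; a finitely generated
torsion branch group is just infinite, so Φ_F(G) has finite index and contains some Stab(m). The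
image of Stab(m) in a finite congruence quotient lies in the Frattini subgroup, hence is nilpotent.
Sections map Stab(m) onto G, so all congruence quotients of G are nilpotent, and with the congruence
property so are all finite quotients of J. Density in J can then be tested in the finite
abelianization, where finitely many elements of D suffice (`exists_fg_denseIn_top`).

Subgroup induction for the coordinate projections of E now gives a level m at which E has full
sections: sections of a dense subgroup are dense, so they cannot be trivial, and finite index forces
equality. Thus E ∩ Stab(m)^k is dense in Stab(m)^k, a subdirect subgroup of a power of G, and maps
onto every factor. A Goursat-type argument using just infiniteness
(`eq_top_of_denseIn_of_map_eq_top`) gives Stab(m)^k ≤ E, so E has finite index and equals J. -/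

section ProfiniteDensity

/-! ### Density in the profinite topology. -/

variable {Γ Δ : Type*} [Group Γ] [Group Δ]

/-- `D` is a subgroup of `J` that is dense in the profinite topology of `J`: no proper subgroup
of finite index of `J` contains `D`. -/
def DenseIn (D J : Subgroup Γ) : Prop :=
  D ≤ J ∧ ∀ F ≤ J, F.relIndex J ≠ 0 → D ≤ F → F = J

theorem DenseIn.eq_of_relIndex_ne_zero {D J : Subgroup Γ} (h : DenseIn D J)
    (hi : D.relIndex J ≠ 0) : D = J :=
  h.2 D h.1 hi le_rfl

theorem DenseIn.map {D J : Subgroup Γ} (h : DenseIn D J) (f : Γ →* Δ) :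
    DenseIn (D.map f) (J.map f) := by
  refine ⟨Subgroup.map_mono h.1, fun F hF hi hD => le_antisymm hF ?_⟩
  have hJ := h.2 (F.comap f ⊓ J) inf_le_right
    (by rwa [Subgroup.inf_relIndex_right, Subgroup.relIndex_comap])
    (le_inf (Subgroup.map_le_iff_le_comap.1 hD) h.1)
  exact Subgroup.map_le_iff_le_comap.2 (inf_eq_right.1 hJ)

theorem DenseIn.subgroupOf {D J : Subgroup Γ} (h : DenseIn D J) {S : Subgroup Γ} (hS : J ≤ S) :
    DenseIn (D.subgroupOf S) (J.subgroupOf S) := by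
  refine ⟨Subgroup.comap_mono h.1, fun F hF hi hD => le_antisymm hF ?_⟩
  have hJS : (J.subgroupOf S).map S.subtype = J := by
    rw [Subgroup.subgroupOf_map_subtype, inf_eq_left.2 hS]
  have hDS : (D.subgroupOf S).map S.subtype = D := by
    rw [Subgroup.subgroupOf_map_subtype, inf_eq_left.2 (h.1.trans hS)]
  have hJ := h.2 (F.map S.subtype) (hJS ▸ Subgroup.map_mono hF)
    (by
      rw [← hJS, Subgroup.relIndex_map_map_of_injective _ _ S.subtype_injective]
      exact hi)
    (hDS ▸ Subgroup.map_mono hD)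
  intro x hx
  have : (x : Γ) ∈ F.map S.subtype := hJ ▸ hx
  obtain ⟨y, hy, hyx⟩ := this
  rwa [← Subtype.ext hyx]

/-- Let N be the normal core in J of a finite-index F ≤ A containing D ∩ A. Density gives J = DN;
since N ≤ F ≤ A, an element of A has its D-part in D ∩ A ≤ F, so A ≤ F. -/
theorem DenseIn.inf {D J A : Subgroup Γ} (h : DenseIn D J) (hA : A ≤ J)
    (hi : A.relIndex J ≠ 0) : DenseIn (D ⊓ A) A := by
  refine ⟨inf_le_right, fun F hF hFA hD => le_antisymm hF fun a ha => ?_⟩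
  have hFJ : (F.subgroupOf J).FiniteIndex := ⟨Subgroup.relIndex_ne_zero_trans hFA hi⟩
  have htop : D.subgroupOf J ⊔ (F.subgroupOf J).normalCore = ⊤ := by
    have hfi : (D.subgroupOf J ⊔ (F.subgroupOf J).normalCore).FiniteIndex :=
      Subgroup.finiteIndex_of_le le_sup_right
    have hd : DenseIn (D.subgroupOf J) (J.subgroupOf J) := h.subgroupOf le_rfl
    rw [Subgroup.subgroupOf_self] at hd
    exact hd.2 _ le_top (by rw [Subgroup.relIndex_top_right]; exact hfi.index_ne_zero) le_sup_left
  have hmem : (⟨a, hA ha⟩ : J) ∈ D.subgroupOf J ⊔ (F.subgroupOf J).normalCore :=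
    htop ▸ Subgroup.mem_top _
  obtain ⟨x, hx, y, hy, hxy⟩ := Subgroup.mem_sup_of_normal_right.1 hmem
  have hyF : (y : Γ) ∈ F := (F.subgroupOf J).normalCore_le hy
  have hxya : (x : Γ) * y = a := congrArg Subtype.val hxy
  have hxA : (x : Γ) ∈ A := by
    rw [eq_mul_inv_of_mul_eq hxya]
    exact A.mul_mem ha (A.inv_mem (hF hyF))
  rw [← hxya]
  exact F.mul_mem (hD ⟨hx, hxA⟩) hyF

theorem IsCoatom.denseIn_top {M : Subgroup Γ} (hM : IsCoatom M) (hi : ¬ M.FiniteIndex) :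
    DenseIn M ⊤ := by
  refine ⟨le_top, fun F _ hF hMF => ?_⟩
  rcases hM.le_iff.1 hMF with h | h
  · exact h
  · subst h
    exact (hi ⟨by rwa [Subgroup.relIndex_top_right] at hF⟩).elim

/-- Images of pairs of finite index have finite index. -/
theorem Subgroup.relIndex_map_ne_zero (f : Γ →* Δ) {K L : Subgroup Γ} (h : K.relIndex L ≠ 0) :
    (K.map f).relIndex (L.map f) ≠ 0 := by
  rw [← Subgroup.relIndex_comap]
  exact fun h0 => h (Subgroup.relIndex_eq_zero_of_le_left (Subgroup.le_comap_map f K) h0)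

theorem Subgroup.fg_map (f : Γ →* Δ) {K : Subgroup Γ} (h : K.FG) : (K.map f).FG := by
  classical
  obtain ⟨S, rfl⟩ := h
  exact ⟨S.image f, by rw [Finset.coe_image, MonoidHom.map_closure]⟩

theorem Subgroup.relIndex_subgroupOf_ne_zero {K L : Subgroup Γ} (S : Subgroup Γ)
    (h : K.relIndex L ≠ 0) : (K.subgroupOf S).relIndex (L.subgroupOf S) ≠ 0 :=
  Subgroup.relIndex_comap_ne_zero S.subtype h

/-! ### Generation modulo commutators in nilpotent quotients. -/

/-- A maximal subgroup of a nilpotent group is normal with cyclic quotient, so it contains the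
commutator subgroup. -/
theorem eq_top_of_sup_commutator_eq_top [Group.IsNilpotent Γ] [Finite Γ] {K : Subgroup Γ}
    (h : K ⊔ commutator Γ = ⊤) : K = ⊤ := by
  by_contra hK
  obtain ⟨L, hL, hKL⟩ := (eq_top_or_exists_le_coatom K).resolve_left hK
  have hn : L.Normal :=
    Subgroup.NormalizerCondition.normal_of_coatom L Group.normalizerCondition_of_isNilpotent hL
  have hsimple : IsSimpleGroup (Γ ⧸ L) := by
    refine { exists_pair_ne := ?_, eq_bot_or_eq_top_of_normal := fun S _ => ?_ }
    · obtain ⟨x, hx⟩ : ∃ x, x ∉ L := by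
        by_contra! hx
        exact hL.1 (eq_top_iff.2 fun x _ => hx x)
      exact ⟨(x : Γ ⧸ L), 1, fun hx1 => hx ((QuotientGroup.eq_one_iff x).1 hx1)⟩
    · have hle : L ≤ S.comap (QuotientGroup.mk' L) := fun x hx => by
        rw [Subgroup.mem_comap, QuotientGroup.mk'_apply, (QuotientGroup.eq_one_iff x).2 hx]
        exact S.one_mem
      have hmap := Subgroup.map_comap_eq_self_of_surjective (QuotientGroup.mk'_surjective L) S
      rcases hL.le_iff.1 hle with ht | ht
      · right
        rw [← hmap, ht, Subgroup.map_top_of_surjective _ (QuotientGroup.mk'_surjective L)]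
      · left
        rw [← hmap, ht, QuotientGroup.map_mk'_self]
  have hcomm : commutator Γ ≤ L := by
    have : IsMulCommutative (Γ ⧸ L) := ⟨⟨fun a b => by
      obtain ⟨g, hg⟩ := IsCyclic.exists_generator (α := Γ ⧸ L)
      obtain ⟨m, rfl⟩ := Subgroup.mem_zpowers_iff.1 (hg a)
      obtain ⟨n, rfl⟩ := Subgroup.mem_zpowers_iff.1 (hg b)
      rw [← zpow_add, ← zpow_add, add_comm]⟩⟩
    rw [commutator_def, Subgroup.commutator_le]
    intro a _ b _
    rw [← QuotientGroup.eq_one_iff]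
    have := this.is_comm.comm (a : Γ ⧸ L) (b : Γ ⧸ L)
    rw [← QuotientGroup.mk'_apply, map_commutatorElement, commutatorElement_eq_one_iff_mul_comm]
    exact this
  exact hL.1 (top_le_iff.1 (h ▸ sup_le hKL hcomm))

/-- If all finite quotients of a finitely generated group `Γ` are nilpotent, then every subgroup
that is dense in the profinite topology contains a finitely generated one. -/
theorem exists_fg_denseIn_top [hfg : Group.FG Γ] (hab : (commutator Γ).FiniteIndex)
    (hnil : ∀ F : Subgroup Γ, F.FiniteIndex →
      ∃ Z ≤ F, ∃ _ : Z.Normal, Z.FiniteIndex ∧ Group.IsNilpotent (Γ ⧸ Z))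
    {D : Subgroup Γ} (hD : DenseIn D ⊤) : ∃ E ≤ D, E.FG ∧ DenseIn E ⊤ := by
  have hsup : D ⊔ commutator Γ = ⊤ := by
    have hfi : (D ⊔ commutator Γ).FiniteIndex := Subgroup.finiteIndex_of_le le_sup_right
    exact hD.2 _ le_top (by rw [Subgroup.relIndex_top_right]; exact hfi.index_ne_zero) le_sup_left
  -- Each generator s is a product of some `δ s` in D and a commutator element; the finitely many `δ
  -- s` generate the required subgroup.
  obtain ⟨S, hS⟩ := hfg.out
  have hdec : ∀ s : Γ, ∃ d ∈ D, ∃ c ∈ commutator Γ, d * c = s := fun s =>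
    Subgroup.mem_sup_of_normal_right.1 (hsup ▸ Subgroup.mem_top s)
  choose δ hδ c hc hδc using hdec
  classical
  refine ⟨Subgroup.closure (S.image δ : Finset Γ), ?_, ⟨_, rfl⟩, le_top, fun F _ hF hEF => ?_⟩
  · rw [Subgroup.closure_le]
    intro x hx
    obtain ⟨s, -, rfl⟩ := Finset.mem_image.1 hx
    exact hδ s
  · obtain ⟨Z, hZF, hZn, hZi, hZnil⟩ :=
      hnil F ⟨by rwa [Subgroup.relIndex_top_right] at hF⟩
    have hFc : F ⊔ commutator Γ = ⊤ := by
      rw [eq_top_iff, ← hS, Subgroup.closure_le]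
      intro s hs
      rw [← hδc s]
      refine Subgroup.mul_mem_sup (hEF (Subgroup.subset_closure ?_)) (hc s)
      exact Finset.mem_image_of_mem δ hs
    have hsurj := QuotientGroup.mk'_surjective Z
    have : F.map (QuotientGroup.mk' Z) = ⊤ := by
      apply eq_top_of_sup_commutator_eq_top
      rw [← Subgroup.map_top_of_surjective _ hsurj, ← hFc, Subgroup.map_sup, commutator_def,
        commutator_def, Subgroup.map_commutator, Subgroup.map_top_of_surjective _ hsurj]
    rw [← Subgroup.comap_map_eq_self (f := QuotientGroup.mk' Z) (H := F)
      (by rwa [QuotientGroup.ker_mk']), this, Subgroup.comap_top]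

/-! ### Dense subgroups of subdirect powers. -/

/-- One step of the induction in `eq_top_of_denseIn_of_map_eq_top`. -/
theorem DenseIn.sup_inf_eq_top {K C N : Subgroup Γ} (hK : DenseIn K ⊤) [C.Normal] [N.Normal]
    (hC : K ⊔ C = ⊤) (hN : K ⊔ N = ⊤)
    (h : ∀ T ≤ C, T.Normal → (T ⊔ N).FiniteIndex ∨
      ∃ F : Subgroup Γ, F.Normal ∧ F.FiniteIndex ∧ T ≤ F ∧ ¬ C ≤ F) :
    K ⊔ (C ⊓ N) = ⊤ := by
  have hdense : ∀ F : Subgroup Γ, F.FiniteIndex → K ≤ F → F = ⊤ := fun F hF =>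
    hK.2 F le_top (by rw [Subgroup.relIndex_top_right]; exact hF.index_ne_zero)
  set K' := K ⊔ (C ⊓ N) with hK'
  have hK'C : K' ⊔ C = ⊤ := top_le_iff.1 (hC ▸ sup_le_sup_right le_sup_left C)
  -- K' normalizes K' ∩ C because C is normal. N does too, since [N, K' ∩ C] ≤ C ∩ N ≤ K'. Together
  -- K' and N generate everything.
  have hTn : (K' ⊓ C).Normal := by
    constructor
    have hgen : ∀ g ∈ K' ⊔ N, ∀ t ∈ K' ⊓ C, g * t * g⁻¹ ∈ K' ⊓ C := by
      intro g hg t ht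
      obtain ⟨x, hx, y, hy, rfl⟩ := Subgroup.mem_sup_of_normal_right.1 hg
      have hyt : y * t * y⁻¹ ∈ K' ⊓ C := by
        have h1 : y * t * y⁻¹ = (y * t * y⁻¹ * t⁻¹) * t := by group
        have h2 : y * t * y⁻¹ * t⁻¹ ∈ C ⊓ N := by
          refine ⟨C.mul_mem (Subgroup.Normal.conj_mem ‹_› t ht.2 y) (C.inv_mem ht.2), ?_⟩
          have h3 : y * t * y⁻¹ * t⁻¹ = y * (t * y⁻¹ * t⁻¹) := by group
          rw [h3]
          exact N.mul_mem hy (Subgroup.Normal.conj_mem ‹_› _ (N.inv_mem hy) t)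
        rw [h1]
        exact (K' ⊓ C).mul_mem ⟨Subgroup.mem_sup_right h2, h2.1⟩ ht
      have h4 : x * y * t * (x * y)⁻¹ = x * (y * t * y⁻¹) * x⁻¹ := by group
      rw [h4]
      exact ⟨K'.mul_mem (K'.mul_mem hx hyt.1) (K'.inv_mem hx),
        Subgroup.Normal.conj_mem ‹_› _ hyt.2 x⟩
    have htop : K' ⊔ N = ⊤ := top_le_iff.1 (hN ▸ sup_le_sup_right le_sup_left N)
    exact fun t ht g => hgen g (htop ▸ Subgroup.mem_top g) t ht
  -- When LC is the whole group, C acts transitively on the cosets of L, so finiteness can be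
  -- checked inside C.
  have hindex : ∀ L : Subgroup Γ, L ⊔ C = ⊤ → (L ⊓ C).relIndex C ≠ 0 → L.FiniteIndex := by
    intro L hL hi
    rw [Subgroup.inf_relIndex_right] at hi
    have hfi : (L.subgroupOf C).FiniteIndex := ⟨hi⟩
    have hfin : Finite (C ⧸ L.subgroupOf C) := inferInstance
    have hfin' : Finite (Γ ⧸ L) := by
      refine Finite.of_surjective (Quotient.map' (s₁ := QuotientGroup.leftRel (L.subgroupOf C))
        (s₂ := QuotientGroup.leftRel L) Subtype.val ?_) ?_
      · intro a b hab
        rw [QuotientGroup.leftRel_apply] at hab ⊢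
        exact hab
      · intro q
        obtain ⟨g, rfl⟩ := QuotientGroup.mk_surjective q
        obtain ⟨c, hc, l, hl, rfl⟩ :=
          Subgroup.mem_sup_of_normal_left.1 (sup_comm L C ▸ hL ▸ Subgroup.mem_top g : g ∈ C ⊔ L)
        refine ⟨QuotientGroup.mk (⟨c, hc⟩ : C), ?_⟩
        refine QuotientGroup.eq.2 ?_
        simpa using hl
    exact Subgroup.finiteIndex_of_finite_quotient
  rcases h _ inf_le_right hTn with hfi | ⟨F, hFn, hFi, hTF, hCF⟩
  · refine hdense K' (hindex K' hK'C ?_) le_sup_left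
    -- Modular law with T = K' ∩ C: TN ∩ C = T(N ∩ C), and N ∩ C ≤ K'. So T has finite index in C,
    -- and K' is the whole group by density.
    have hTN : (K' ⊓ C ⊔ N) ⊓ C ≤ K' ⊓ C := by
      rintro x ⟨hx, hxC⟩
      obtain ⟨t, ht, n, hn, rfl⟩ := Subgroup.mem_sup_of_normal_right.1 hx
      have hnC : n ∈ C := by
        have := C.mul_mem (C.inv_mem ht.2) hxC
        rwa [inv_mul_cancel_left] at this
      exact (K' ⊓ C).mul_mem ht ⟨Subgroup.mem_sup_right ⟨hnC, hn⟩, hnC⟩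
    intro h0
    have h1 := Subgroup.relIndex_eq_zero_of_le_left hTN h0
    rw [Subgroup.inf_relIndex_right] at h1
    exact hfi.index_ne_zero (Subgroup.index_eq_zero_of_relIndex_eq_zero h1)
  · exfalso
    -- Density makes K'(F ∩ C) the whole group, so C = (K' ∩ C)(F ∩ C) ≤ F, a contradiction.
    have hL : K' ⊔ F ⊓ C = ⊤ := by
      refine hdense _ (hindex _ ?_ ?_) (le_sup_left.trans le_sup_left)
      · exact top_le_iff.1 (hK'C ▸ sup_le_sup_right le_sup_left C)
      · intro h0
        have h1 := Subgroup.relIndex_eq_zero_of_le_left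
          (le_inf (le_sup_right (a := K')) (inf_le_right (a := F))) h0
        rw [Subgroup.inf_relIndex_right] at h1
        exact hFi.index_ne_zero (Subgroup.index_eq_zero_of_relIndex_eq_zero h1)
    apply hCF
    intro c hc
    obtain ⟨x, hx, y, hy, rfl⟩ :=
      Subgroup.mem_sup_of_normal_right.1 (hL ▸ Subgroup.mem_top c : c ∈ K' ⊔ F ⊓ C)
    refine F.mul_mem (hTF ⟨hx, ?_⟩) hy.1
    have := C.mul_mem hc (C.inv_mem hy.2)
    rwa [mul_inv_cancel_right] at this

/-- A subgroup of a subdirect power of a just infinite residually finite group that is dense in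
the profinite topology and maps onto all factors is the whole group. -/
theorem eq_top_of_denseIn_of_map_eq_top {ι : Type*} [Finite ι] (π : ι → Γ →* Δ)
    (hπ : ∀ i, Function.Surjective (π i))
    (hJI : ∀ R : Subgroup Δ, R.Normal → R ≠ ⊥ → R.FiniteIndex)
    (hRF : ∀ x : Δ, x ≠ 1 → ∃ F : Subgroup Δ, F.Normal ∧ F.FiniteIndex ∧ x ∉ F)
    (hinj : ∀ g, (∀ i, π i g = 1) → g = 1)
    (hsep : ∀ i, ∃ c, π i c ≠ 1 ∧ ∀ j ≠ i, π j c = 1)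
    {K : Subgroup Γ} (hK : DenseIn K ⊤) (hKπ : ∀ i, K.map (π i) = ⊤) : K = ⊤ := by
  classical
  have := Fintype.ofFinite ι
  have key : ∀ s : Finset ι, K ⊔ (⨅ i ∈ s, (π i).ker) = ⊤ := by
    intro s
    induction s using Finset.induction_on with
    | empty => simp
    | insert i s his ih =>
      rw [Finset.iInf_insert, inf_comm]
      have hCn : (⨅ i ∈ s, (π i).ker).Normal :=
        Subgroup.normal_iInf_normal fun i => Subgroup.normal_iInf_normal fun _ => inferInstance
      refine hK.sup_inf_eq_top ih ?_ fun T _ hTn => ?_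
      · have := hKπ i
        rw [← Subgroup.comap_map_eq, this, Subgroup.comap_top]
      · by_cases hT : T.map (π i) = ⊥
        · right
          obtain ⟨c, hc, hc'⟩ := hsep i
          obtain ⟨F, hFn, hFi, hcF⟩ := hRF _ hc
          refine ⟨F.comap (π i), inferInstance, ⟨?_⟩, ?_, fun hle => hcF (hle ?_)⟩
          · rw [Subgroup.index_comap_of_surjective _ (hπ i)]
            exact hFi.index_ne_zero
          · rw [← Subgroup.map_le_iff_le_comap, hT]
            exact bot_le
          · simp only [Subgroup.mem_iInf, MonoidHom.mem_ker]
            exact fun j hj => hc' j fun hji => his (hji ▸ hj)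
        · left
          have hfi := hJI _ (hTn.map _ (hπ i)) hT
          rw [← Subgroup.comap_map_eq]
          refine ⟨?_⟩
          rw [Subgroup.index_comap_of_surjective _ (hπ i)]
          exact hfi.index_ne_zero
  have hbot : (⨅ i ∈ (Finset.univ : Finset ι), (π i).ker) = ⊥ := by
    rw [eq_bot_iff]
    intro g hg
    simp only [Finset.mem_univ, Subgroup.mem_iInf, MonoidHom.mem_ker, true_implies] at hg
    exact Subgroup.mem_bot.2 (hinj g hg)
  have := key Finset.univ
  rwa [hbot, sup_bot_eq] at this

/-- A finitely generated abelian torsion group is finite. -/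
theorem finiteIndex_of_commutator_le [hfg : Group.FG Γ] (htor : ∀ g : Γ, IsOfFinOrder g)
    {N : Subgroup Γ} [N.Normal] (h : commutator Γ ≤ N) : N.FiniteIndex := by
  have hcomm : ∀ a b : Γ ⧸ N, a * b = b * a := by
    intro a b
    obtain ⟨x, rfl⟩ := QuotientGroup.mk_surjective a
    obtain ⟨y, rfl⟩ := QuotientGroup.mk_surjective b
    rw [← commutatorElement_eq_one_iff_mul_comm, ← QuotientGroup.mk'_apply,
      ← QuotientGroup.mk'_apply, ← map_commutatorElement, QuotientGroup.mk'_apply,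
      QuotientGroup.eq_one_iff]
    exact h (Subgroup.commutator_mem_commutator (Subgroup.mem_top x) (Subgroup.mem_top y))
  let _ : CommGroup (Γ ⧸ N) := { (inferInstance : Group (Γ ⧸ N)) with mul_comm := hcomm }
  have hfin : Finite (Γ ⧸ N) := by
    refine CommGroup.finite_of_fg_isMulTorsion (Γ ⧸ N) ?_
    intro a
    obtain ⟨x, rfl⟩ := QuotientGroup.mk_surjective a
    exact (QuotientGroup.mk' N).isOfFinOrder (htor x)
  exact Subgroup.finiteIndex_of_finite_quotient

end ProfiniteDensity

/-! ### Levels, sections and transversals. -/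

namespace RegTree

variable {d : ℕ}

theorem apply_nil (g : TreeAut d) : g [] = [] := by
  have h : g [] <+: g (g⁻¹ []) := g.map_rel_iff.2 List.nil_prefix
  rw [RelIso.apply_inv_self] at h
  exact List.prefix_nil.1 h

theorem length_apply_singleton (g : TreeAut d) (x : Fin d) : (g [x]).length = 1 := by
  rcases hgx : g [x] with _ | ⟨y, t⟩
  · rw [← apply_nil g] at hgx
    exact absurd (g.injective hgx) (by simp)
  · have h : g⁻¹ [y] <+: g⁻¹ (g [x]) := g⁻¹.map_rel_iff.2 (by rw [hgx]; simp)
    rw [RelIso.inv_apply_self] at h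
    have hne : g⁻¹ [y] ≠ [] := fun h0 => by
      rw [← apply_nil g⁻¹] at h0
      exact absurd (g⁻¹.injective h0) (by simp)
    have heq : g⁻¹ [y] = [x] := h.eq_of_length (le_antisymm h.length_le
      (by rw [List.length_singleton]; exact List.length_pos_of_ne_nil hne))
    rw [← hgx, ← heq, RelIso.apply_inv_self]
    rfl

@[simp]
theorem length_apply (g : TreeAut d) (v : Vertex d) : (g v).length = v.length := by
  induction v using List.reverseRecOn with
  | nil => rw [apply_nil]
  | append_singleton v x ih =>
    rw [apply_append_sec, List.length_append, List.length_append, ih, length_apply_singleton]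
    rfl

theorem apply_eq_of_prefix {g : TreeAut d} {v w : Vertex d} (hvw : v <+: w) (hw : g w = w) :
    g v = v := by
  have h : g v <+: w := by
    rw [← hw]
    exact g.map_rel_iff.2 hvw
  have h' := List.prefix_of_prefix_length_le h hvw (length_apply g v).le
  exact h'.eq_of_length (length_apply g v)

theorem exists_prefix_length (hd : 0 < d) {n : ℕ} {v : Vertex d} (hv : v.length ≤ n) :
    ∃ w, (v ++ w).length = n :=
  ⟨List.replicate (n - v.length) ⟨0, hd⟩, by simp [hv]⟩

theorem apply_eq_of_mem_stab_level (hd : 0 < d) {n : ℕ} {g : TreeAut d}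
    (hg : g ∈ stab (level d n)) {v : Vertex d} (hv : v.length ≤ n) : g v = v := by
  obtain ⟨w, hw⟩ := exists_prefix_length hd hv
  exact apply_eq_of_prefix (List.prefix_append v w) (hg _ hw)

theorem stab_level_anti (hd : 0 < d) {m n : ℕ} (hmn : m ≤ n) :
    stab (level d n) ≤ stab (level d m) :=
  fun _ hg v hv => apply_eq_of_mem_stab_level hd hg ((show v.length = m from hv).trans_le hmn)

theorem stab_level_le_stab_singleton {n : ℕ} {v : Vertex d} (hv : v ∈ level d n) :
    stab (level d n) ≤ stab {v} := by
  rintro g hg w rfl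
  exact hg _ hv

instance stab_level_normal (n : ℕ) : (stab (level d n)).Normal := by
  refine ⟨fun g hg x v hv => ?_⟩
  have hv' : x⁻¹ v ∈ level d n := (length_apply _ _).trans hv
  rw [RelIso.mul_apply, RelIso.mul_apply, hg _ hv', RelIso.apply_inv_self]

theorem finite_level (n : ℕ) : (level d n).Finite :=
  List.finite_length_eq (Fin d) n

theorem finiteIndex_stab_singleton (v : Vertex d) : (stab ({v} : Set (Vertex d))).FiniteIndex := by
  have h : stab ({v} : Set (Vertex d)) = MulAction.stabilizer (TreeAut d) v := by
    ext g
    exact ⟨fun hg => hg v rfl, fun hg w hw => by rw [Set.mem_singleton_iff.1 hw]; exact hg⟩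
  rw [h]
  have hfin : (MulAction.orbit (TreeAut d) v).Finite := by
    refine (finite_level v.length).subset ?_
    rintro _ ⟨g, rfl⟩
    exact length_apply g v
  refine ⟨?_⟩
  rw [MulAction.index_stabilizer]
  exact (Set.ncard_pos hfin).2 ⟨v, MulAction.mem_orbit_self v⟩ |>.ne'

theorem finiteIndex_stab {V : Set (Vertex d)} (hV : V.Finite) : (stab V).FiniteIndex := by
  have : Finite V := hV
  have hfi : (⨅ v : V, stab ({v.1} : Set (Vertex d))).FiniteIndex :=
    Subgroup.finiteIndex_iInf fun v => finiteIndex_stab_singleton v.1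
  refine Subgroup.finiteIndex_of_le (H := ⨅ v : V, stab ({v.1} : Set (Vertex d))) ?_
  intro g hg v hv
  exact Subgroup.mem_iInf.1 hg ⟨v, hv⟩ v rfl

instance finiteIndex_stab_level (n : ℕ) : (stab (level d n)).FiniteIndex :=
  finiteIndex_stab (finite_level n)

theorem sec_append (g : TreeAut d) (v w : Vertex d) : sec (v ++ w) g = sec w (sec v g) := by
  refine RelIso.ext fun u => sectionFun_eq ?_
  rw [List.append_assoc, apply_append_sec g v, apply_append_sec (sec v g), apply_append_sec g v,
    List.append_assoc]

theorem mem_secImage {v : Vertex d} {K : Subgroup (TreeAut d)} {h : TreeAut d} :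
    h ∈ secImage v K ↔ ∃ g ∈ K, g v = v ∧ sec v g = h := by
  constructor
  · rintro ⟨g, hg, rfl⟩
    exact ⟨g, hg, g.2 v rfl, rfl⟩
  · rintro ⟨g, hg, hgv, rfl⟩
    exact ⟨⟨g, fun w hw => by rw [Set.mem_singleton_iff.1 hw, hgv]⟩, hg, rfl⟩

theorem secImage_mono (v : Vertex d) {K L : Subgroup (TreeAut d)} (h : K ≤ L) :
    secImage v K ≤ secImage v L :=
  Subgroup.map_mono (Subgroup.comap_mono h)

theorem secImage_append (v w : Vertex d) (K : Subgroup (TreeAut d)) :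
    secImage (v ++ w) K = secImage w (secImage v K) := by
  ext h
  simp only [mem_secImage]
  constructor
  · rintro ⟨g, hg, hgvw, rfl⟩
    have hgv := apply_eq_of_prefix (List.prefix_append v w) hgvw
    refine ⟨_, ⟨g, hg, hgv, rfl⟩, ?_, (sec_append g v w).symm⟩
    rw [apply_append_sec, hgv] at hgvw
    exact List.append_cancel_left hgvw
  · rintro ⟨_, ⟨g, hg, hgv, rfl⟩, hw, rfl⟩
    exact ⟨g, hg, by rw [apply_append_sec, hgv, hw], sec_append g v w⟩

theorem relIndex_secImage_ne_zero (v : Vertex d) {K L : Subgroup (TreeAut d)}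
    (h : K.relIndex L ≠ 0) : (secImage v K).relIndex (secImage v L) ≠ 0 :=
  Subgroup.relIndex_map_ne_zero _ (Subgroup.relIndex_subgroupOf_ne_zero _ h)

theorem _root_.DenseIn.secImage {D J : Subgroup (TreeAut d)} (h : DenseIn D J) {v : Vertex d}
    (hJ : J ≤ stab {v}) : DenseIn (secImage v D) (secImage v J) :=
  (h.subgroupOf hJ).map _

theorem ofFn_eq_map_range (ξ : ℕ → Fin d) (n : ℕ) :
    (List.ofFn fun i : Fin n => ξ i) = (List.range n).map ξ :=
  List.ext_getElem (by simp) (by simp)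

/-- The open cylinders over the vertices of X cover the compact space of rays. They are disjoint and
nonempty, so a finite subcover uses all of X. -/
theorem IsTransversal.finite (hd : 0 < d) {X : Set (Vertex d)} (hX : IsTransversal X) :
    X.Finite := by
  let U : X → Set (ℕ → Fin d) := fun v => {ξ | ∀ i : Fin v.1.length, ξ i = v.1.get i}
  have hU : ∀ v, IsOpen (U v) := fun v => by
    have : U v = ⋂ i : Fin v.1.length, (fun ξ : ℕ → Fin d => ξ i) ⁻¹' {v.1.get i} := by
      ext ξ
      simp [U]
    rw [this]
    exact isOpen_iInter_of_finite fun i => (isOpen_discrete _).preimage (continuous_apply _)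
  have hmem : ∀ (v : X) (ξ : ℕ → Fin d), ξ ∈ U v ↔ ∃ n, v.1 = List.ofFn fun i : Fin n => ξ i := by
    intro v ξ
    constructor
    · intro h
      refine ⟨v.1.length, ?_⟩
      conv_lhs => rw [← List.ofFn_get v.1]
      congr 1
      funext i
      exact (h i).symm
    · rintro ⟨n, hn⟩ i
      simp [hn]
  obtain ⟨t, ht⟩ := isCompact_univ.elim_finite_subcover U hU fun ξ _ => by
    obtain ⟨v, ⟨hv, hn⟩, -⟩ := hX ξ
    exact Set.mem_iUnion.2 ⟨⟨v, hv⟩, (hmem _ ξ).2 hn⟩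
  refine (t.image Subtype.val).finite_toSet.subset fun v hv => ?_
  let ξ : ℕ → Fin d := fun i => v.getD i ⟨0, hd⟩
  have hξ : ξ ∈ U ⟨v, hv⟩ := fun i => by simp [ξ]
  obtain ⟨w, hw⟩ := Set.mem_iUnion.1 (ht (Set.mem_univ ξ))
  obtain ⟨hwt, hwξ⟩ := Set.mem_iUnion.1 hw
  have := (hX ξ).unique ⟨hv, (hmem ⟨v, hv⟩ ξ).1 hξ⟩ ⟨w.2, (hmem w ξ).1 hwξ⟩
  simp only [Finset.coe_image, Set.mem_image, Finset.mem_coe]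
  exact ⟨w, hwt, this.symm⟩

theorem IsTransversal.exists_prefix_or_prefix (hd : 0 < d) {X : Set (Vertex d)}
    (hX : IsTransversal X) (w : Vertex d) : ∃ v ∈ X, v <+: w ∨ w <+: v := by
  -- Padding w with the letter 0 gives a ray; w and the vertex of X on that ray are prefixes of the
  -- same infinite word.
  let ξ : ℕ → Fin d := fun i => w.getD i ⟨0, hd⟩
  obtain ⟨v, ⟨hv, n, hn⟩, -⟩ := hX ξ
  have hw : w = (List.range w.length).map ξ :=
    List.ext_getElem (by simp) fun i h1 h2 => by simp [ξ, h1]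
  rw [ofFn_eq_map_range] at hn
  have hpre : ∀ {a b : ℕ}, a ≤ b → (List.range a).map ξ <+: (List.range b).map ξ := fun hab => by
    refine List.IsPrefix.map _ ?_
    rw [List.prefix_iff_eq_take]
    simp [List.take_range, hab]
  refine ⟨v, hv, ?_⟩
  rw [hn, hw]
  rcases le_total n w.length with h | h
  · exact Or.inl (hpre h)
  · exact Or.inr (hpre h)

/-- The comparability hypothesis on X holds both for transversals and for levels. -/
theorem eq_one_of_sec_eq_one {g : TreeAut d} {X : Set (Vertex d)} (hg : g ∈ stab X)
    (hX : ∀ w : Vertex d, ∃ v ∈ X, v <+: w ∨ w <+: v) (h : ∀ v ∈ X, sec v g = 1) : g = 1 := by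
  refine RelIso.ext fun w => ?_
  obtain ⟨v, hv, ⟨u, rfl⟩ | hwv⟩ := hX w
  · rw [apply_append_sec, h v hv, hg v hv]
    rfl
  · exact apply_eq_of_prefix hwv (hg v hv)

theorem exists_level_prefix_or_prefix (hd : 0 < d) (n : ℕ) (w : Vertex d) :
    ∃ v ∈ level d n, v <+: w ∨ w <+: v := by
  rcases le_total w.length n with h | h
  · obtain ⟨u, hu⟩ := exists_prefix_length hd h
    exact ⟨w ++ u, hu, Or.inr (List.prefix_append w u)⟩
  · exact ⟨w.take n, by simp [level, h], Or.inl (List.take_prefix n w)⟩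

/-! ### Rigid stabilizers. -/

theorem rist_le (G : Subgroup (TreeAut d)) (v : Vertex d) : rist G v ≤ G := inf_le_left

theorem apply_of_mem_rist {G : Subgroup (TreeAut d)} {v w : Vertex d} {g : TreeAut d}
    (hg : g ∈ rist G v) (hw : ¬ v <+: w) : g w = w :=
  hg.2 w hw

theorem prefix_apply_of_mem_rist {G : Subgroup (TreeAut d)} {v w : Vertex d} {g : TreeAut d}
    (hg : g ∈ rist G v) (hw : v <+: w) : v <+: g w := by
  by_contra h
  have := g.injective (apply_of_mem_rist hg h)
  exact h (by rw [this]; exact hw)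

theorem rist_le_stab_level {G : Subgroup (TreeAut d)} {v : Vertex d} {n : ℕ}
    (hv : v ∈ level d n) : rist G v ≤ stab (level d n) := by
  intro g hg w hw
  by_cases h : v <+: w
  · have hvw : v = w := h.eq_of_length ((show v.length = n from hv).trans (Eq.symm hw))
    subst hvw
    exact ((prefix_apply_of_mem_rist hg h).eq_of_length (length_apply g v).symm).symm
  · exact apply_of_mem_rist hg h

theorem conj_mem_rist {G : Subgroup (TreeAut d)} {v : Vertex d} {g x : TreeAut d} (hg : g ∈ G)
    (hx : x ∈ rist G v) : g * x * g⁻¹ ∈ rist G (g v) := by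
  refine ⟨G.mul_mem (G.mul_mem hg hx.1) (G.inv_mem hg), fun w hw => ?_⟩
  have h : ¬ v <+: g⁻¹ w := fun h => hw (by
    have := g.map_rel_iff.2 h
    rwa [RelIso.apply_inv_self] at this)
  rw [RelIso.mul_apply, RelIso.mul_apply, apply_of_mem_rist hx h, RelIso.apply_inv_self]

theorem not_prefix_of_prefix {v w u : Vertex d} (hl : v.length = w.length) (hne : v ≠ w)
    (hv : v <+: u) : ¬ w <+: u := fun hw =>
  hne ((List.prefix_of_prefix_length_le hv hw hl.le).eq_of_length hl)

theorem commute_of_mem_rist {G : Subgroup (TreeAut d)} {v w : Vertex d}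
    (hl : v.length = w.length) (hne : v ≠ w) {a b : TreeAut d} (ha : a ∈ rist G v)
    (hb : b ∈ rist G w) : a * b = b * a := by
  refine RelIso.ext fun u => ?_
  rw [RelIso.mul_apply, RelIso.mul_apply]
  by_cases hv : v <+: u
  · rw [apply_of_mem_rist hb (not_prefix_of_prefix hl hne hv),
      apply_of_mem_rist hb (not_prefix_of_prefix hl hne (prefix_apply_of_mem_rist ha hv))]
  · rw [apply_of_mem_rist ha hv]
    by_cases hw : w <+: u
    · exact apply_of_mem_rist ha
        (not_prefix_of_prefix hl.symm hne.symm (prefix_apply_of_mem_rist hb hw))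
    · rw [apply_of_mem_rist hb hw, apply_of_mem_rist ha hv]

theorem sec_eq_one_of_mem_rist {G : Subgroup (TreeAut d)} {v w : Vertex d}
    (hl : v.length = w.length) (hne : v ≠ w) {a : TreeAut d} (ha : a ∈ rist G v) :
    sec w a = 1 := by
  have hn : ∀ u : Vertex d, w <+: u → a u = u := fun u hu =>
    apply_of_mem_rist ha (not_prefix_of_prefix hl.symm hne.symm hu)
  refine RelIso.ext fun u => sectionFun_eq ?_
  rw [hn _ (List.prefix_append w u), hn w (List.prefix_refl w)]
  rfl

theorem sec_ne_one_of_mem_rist {G : Subgroup (TreeAut d)} {v : Vertex d} {a : TreeAut d}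
    (ha : a ∈ rist G v) (h1 : a ≠ 1) : sec v a ≠ 1 := fun h => h1 <| by
  refine RelIso.ext fun u => ?_
  by_cases hu : v <+: u
  · obtain ⟨t, rfl⟩ := hu
    rw [apply_append_sec, h, rist_le_stab_level rfl ha v rfl]
    rfl
  · exact apply_of_mem_rist ha hu

/-- A subgroup of finite index cannot meet an infinite subgroup trivially. -/
theorem IsBranch.exists_mem_rist_ne_one {G : Subgroup (TreeAut d)} (hG : IsBranch G)
    {C : Subgroup (TreeAut d)} (hC : C.relIndex G ≠ 0) (v : Vertex d) :
    ∃ a ∈ C, a ∈ rist G v ∧ a ≠ 1 := by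
  by_contra! h
  have hbot : C ⊓ rist G v = ⊥ := (Subgroup.eq_bot_iff_forall _).2 fun a ha => h a ha.1 ha.2
  have hrel : C.relIndex (rist G v) ≠ 0 :=
    fun h0 => hC (Subgroup.relIndex_eq_zero_of_le_right (rist_le G v) h0)
  rw [← Subgroup.inf_relIndex_right, hbot, Subgroup.relIndex_bot_left] at hrel
  have := hG.infinite_rist v
  exact hrel Nat.card_eq_zero_of_infinite

/-- A branch group has no commutative subgroup of finite index. -/
theorem IsBranch.exists_not_commute {G : Subgroup (TreeAut d)} (hG : IsBranch G)
    {C : Subgroup (TreeAut d)} (hC : C.relIndex G ≠ 0) : ∃ a ∈ C, ∃ b ∈ C, a * b ≠ b * a := by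
  obtain ⟨a, haC, haG, ha1⟩ := hG.exists_mem_rist_ne_one hC []
  obtain ⟨u, hu⟩ : ∃ u, a u ≠ u := by
    by_contra! h
    exact ha1 (RelIso.ext h)
  obtain ⟨b, hbC, hbG, hb1⟩ := hG.exists_mem_rist_ne_one hC u
  -- If a commuted with b, then b = aba⁻¹ would be supported below both u and a u, which are
  -- distinct vertices of one level.
  refine ⟨a, haC, b, hbC, fun hab => hb1 ?_⟩
  have hconj : b ∈ rist G (a u) := by
    have := conj_mem_rist (rist_le G _ haG) hbG
    rwa [hab, mul_inv_cancel_right] at this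
  refine RelIso.ext fun w => ?_
  by_cases hw : u <+: w
  · exact apply_of_mem_rist hconj (not_prefix_of_prefix (length_apply a u).symm hu.symm hw)
  · exact apply_of_mem_rist hbG hw

end RegTree

/-- Conjugation permutes the maximal subgroups of finite index. -/
theorem frattiniFin_normal (Γ : Type*) [Group Γ] : (frattiniFin Γ).Normal := by
  refine ⟨fun x hx g => ?_⟩
  refine Subgroup.mem_sInf.2 fun M hM => ?_
  have hx' := Subgroup.mem_sInf.1 hx (M.comap (MulAut.conj g).toMonoidHom) ⟨?_, ⟨?_⟩⟩
  · simpa using hx'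
  · exact ((MulAut.conj g).comapSubgroup.isCoatom_iff M).2 hM.1
  · rw [Subgroup.index_comap_of_surjective _ (MulAut.conj g).surjective]
    exact hM.2.index_ne_zero

/-! ### Torsion, just infiniteness and nilpotent congruence quotients. -/

namespace RegTree

open scoped commutatorElement

variable {d : ℕ} {G : Subgroup (TreeAut d)}

/-- This turns the finite-index alternative of subgroup induction into finite index in G itself. -/
theorem IsStronglySelfReplicating.secImage_stab (hG : IsStronglySelfReplicating G)
    (v : Vertex d) : secImage v (G ⊓ stab {v}) = G := by
  refine le_antisymm (hG.selfSimilar v) ?_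
  conv_lhs => rw [← hG.secImage_eq v.length v rfl]
  exact secImage_mono v (inf_le_inf_left G (stab_level_le_stab_singleton rfl))

/-- The homomorphism `φ_v : Stab_G(level n) → G`, for a vertex `v` of level `n`. -/
def levelSec (hG : IsStronglySelfReplicating G) {n : ℕ} {v : Vertex d} (hv : v ∈ level d n) :
    (stab (level d n)).subgroupOf G →* G where
  toFun g := ⟨sec v g,
    (hG.secImage_eq n v hv).le (mem_secImage.2 ⟨g, ⟨g.1.2, g.2⟩, g.2 v hv, rfl⟩)⟩
  map_one' := Subtype.ext (map_one (secHom v))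
  map_mul' a b := Subtype.ext <| map_mul (secHom v)
    ⟨a, stab_level_le_stab_singleton hv a.2⟩ ⟨b, stab_level_le_stab_singleton hv b.2⟩

theorem levelSec_surjective (hG : IsStronglySelfReplicating G) {n : ℕ} {v : Vertex d}
    (hv : v ∈ level d n) : Function.Surjective (levelSec hG hv) := by
  rintro ⟨h, hh⟩
  rw [← hG.secImage_eq n v hv] at hh
  obtain ⟨g, hg, -, rfl⟩ := mem_secImage.1 hh
  exact ⟨⟨⟨g, hg.1⟩, hg.2⟩, rfl⟩

/-- A strongly self-replicating branch group with the subgroup induction property is torsion. -/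
theorem isOfFinOrder_of_mem (hd : 0 < d) (hssr : IsStronglySelfReplicating G)
    (hbranch : IsBranch G) (hsip : HasSubgroupInductionProperty G) {g : TreeAut d} (hg : g ∈ G) :
    IsOfFinOrder g := by
  obtain ⟨X, hX, hXv⟩ := hsip (Subgroup.zpowers g) (by simpa using hg)
    ⟨{g}, by simp [Subgroup.zpowers_eq_closure]⟩
  have hfi := finiteIndex_stab (hX.finite hd)
  -- If all sections are trivial, the finite-index subgroup Stab(X) ∩ ⟨g⟩ is trivial and ⟨g⟩ is
  -- finite. Otherwise some section group is abelian and of finite index in G, which a branch group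
  -- forbids.
  by_cases h : ∀ v ∈ X, secImage v (Subgroup.zpowers g ⊓ stab X) = ⊥
  · have hbot : stab X ⊓ Subgroup.zpowers g = ⊥ := by
      rw [Subgroup.eq_bot_iff_forall]
      intro x hx
      refine eq_one_of_sec_eq_one hx.1 (hX.exists_prefix_or_prefix hd) fun v hv => ?_
      rw [← Subgroup.mem_bot, ← h v hv]
      exact mem_secImage.2 ⟨x, ⟨hx.2, hx.1⟩, hx.1 v hv, rfl⟩
    have hrel : (stab X).relIndex (Subgroup.zpowers g) ≠ 0 :=
      fun h0 => hfi.index_ne_zero (Subgroup.index_eq_zero_of_relIndex_eq_zero h0)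
    rw [← Subgroup.inf_relIndex_right, hbot, Subgroup.relIndex_bot_left, Nat.card_zpowers] at hrel
    exact orderOf_ne_zero_iff.1 hrel
  · push Not at h
    obtain ⟨v, hv, hne⟩ := h
    have hrel := ((hXv v hv).resolve_left hne).relIndex_ne_zero
    rw [hssr.secImage_stab] at hrel
    obtain ⟨a, ha, b, hb, hab⟩ := hbranch.exists_not_commute hrel
    obtain ⟨⟨x, hx⟩, hxm, rfl⟩ := ha
    obtain ⟨⟨y, hy⟩, hym, rfl⟩ := hb
    exfalso
    apply hab
    rw [← map_mul, ← map_mul]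
    congr 1
    obtain ⟨i, hi⟩ := Subgroup.mem_zpowers_iff.1 hxm.1
    obtain ⟨j, hj⟩ := Subgroup.mem_zpowers_iff.1 hym.1
    refine Subtype.ext ?_
    simp only [Subgroup.coe_subtype] at hi hj
    simp only [Subgroup.coe_mul]
    rw [← hi, ← hj, ← zpow_add, ← zpow_add, add_comm]

/-- The double commutator trick: ac = [a, r] lies in R, and c is supported below r v, so it commutes
with b. Hence [a, b] = [ac, b] ∈ R. -/
theorem commutator_rist_le {R : Subgroup G} [hRn : R.Normal] {r : G} (hr : r ∈ R) {v : Vertex d}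
    (hrv : r.1 v ≠ v) {a b : G} (ha : a.1 ∈ rist G v) (hb : b.1 ∈ rist G v) : ⁅a, b⁆ ∈ R := by
  set c : G := r * a⁻¹ * r⁻¹ with hc
  have hcr : c.1 ∈ rist G (r.1 v) := conj_mem_rist r.2 ((rist G v).inv_mem ha)
  have hcb : c * b = b * c :=
    Subtype.ext (commute_of_mem_rist (length_apply _ v) hrv hcr hb)
  have hac : a * c ∈ R := by
    have h : a * c = (a * r * a⁻¹) * r⁻¹ := by rw [hc]; group
    rw [h]
    exact R.mul_mem (hRn.conj_mem r hr a) (R.inv_mem hr)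
  have h : ⁅a, b⁆ = (a * c) * (b * (a * c)⁻¹ * b⁻¹) := by
    have h1 : (a * c) * (b * (a * c)⁻¹ * b⁻¹) = a * (c * b) * c⁻¹ * a⁻¹ * b⁻¹ := by group
    rw [h1, hcb, commutatorElement_def]
    group
  rw [h]
  exact R.mul_mem hac (hRn.conj_mem _ (R.inv_mem hac) b)

/-- A finitely generated torsion branch group is just infinite. -/
theorem IsBranch.finiteIndex_of_normal (hbranch : IsBranch G) [Group.FG G]
    (htor : ∀ g : G, IsOfFinOrder g) {R : Subgroup G} (hRn : R.Normal) (hR : R ≠ ⊥) :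
    R.FiniteIndex := by
  obtain ⟨r, hr, hr1⟩ := R.bot_or_exists_ne_one.resolve_left hR
  obtain ⟨v, hv⟩ : ∃ v, r.1 v ≠ v := by
    by_contra! h
    exact hr1 (Subtype.ext (RelIso.ext h))
  have hw : ∀ w ∈ level d v.length, ∀ a b : G, a.1 ∈ rist G w → b.1 ∈ rist G w → ⁅a, b⁆ ∈ R := by
    intro w hw a b ha hb
    obtain ⟨g, hg, rfl⟩ := hbranch.transitive v.length v rfl w hw
    have hconj : ∀ x : G, x.1 ∈ rist G (g v) →
        ((⟨g, hg⟩⁻¹ * x * ⟨g, hg⟩ : G) : TreeAut d) ∈ rist G v := by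
      intro x hx
      have := conj_mem_rist (G.inv_mem hg) hx
      rwa [RelIso.inv_apply_self, inv_inv] at this
    have h := hRn.conj_mem _ (commutator_rist_le hr hv (hconj a ha) (hconj b hb)) ⟨g, hg⟩
    convert h using 1
    simp only [commutatorElement_def]
    group
  set Q := (ristLevel G v.length).subgroupOf G with hQdef
  have hQi : Q.FiniteIndex :=
    Subgroup.isFiniteRelIndex_iff_finiteIndex.1 (hbranch.finiteIndex_ristLevel v.length)
  -- Images of rigid stabilizers commute modulo R: at one vertex by `hw`, at distinct vertices by
  -- disjoint supports. So the finite-index subgroup Q has abelian image in G/R.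
  let S : Set (G ⧸ R) :=
    {y | ∃ w ∈ level d v.length, ∃ x : G, x.1 ∈ rist G w ∧ (x : G ⧸ R) = y}
  have hS : ∀ x ∈ S, ∀ y ∈ S, x * y = y * x := by
    rintro _ ⟨w, hwl, x, hx, rfl⟩ _ ⟨w', hwl', y, hy, rfl⟩
    rw [← QuotientGroup.mk_mul, ← QuotientGroup.mk_mul]
    by_cases hne : w = w'
    · subst hne
      rw [QuotientGroup.mk_mul, QuotientGroup.mk_mul, ← commutatorElement_eq_one_iff_mul_comm,
        ← QuotientGroup.mk'_apply, ← QuotientGroup.mk'_apply, ← map_commutatorElement,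
        QuotientGroup.mk'_apply, QuotientGroup.eq_one_iff]
      exact hw w hwl x y hx hy
    · congr 1
      exact Subtype.ext (commute_of_mem_rist (Eq.trans hwl (Eq.symm hwl')) hne hx hy)
  have hcomm := Subgroup.isMulCommutative_closure hS
  have hQS : Q ≤ (Subgroup.closure S).comap (QuotientGroup.mk' R) := by
    have hle : ristLevel G v.length ≤
        ((Subgroup.closure S).comap (QuotientGroup.mk' R)).map G.subtype := by
      refine iSup₂_le fun w hwl x hx => ⟨⟨x, hx.1⟩, ?_, rfl⟩
      exact Subgroup.subset_closure ⟨w, hwl, ⟨x, hx.1⟩, hx, rfl⟩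
    intro x hx
    obtain ⟨y, hy, hyx⟩ := hle hx
    rwa [← Subtype.ext hyx]
  have hQR : R.relIndex Q ≠ 0 := by
    have hfg : Group.FG Q := Subgroup.fg_of_index_ne_zero Q
    have : (R.subgroupOf Q).FiniteIndex := by
      refine finiteIndex_of_commutator_le (fun g => ?_) ?_
      · exact Q.subtype_injective.isOfFinOrder_iff.1 (htor g)
      · rw [commutator_def, Subgroup.commutator_le]
        intro a _ b _
        change ⁅(a : G), (b : G)⁆ ∈ R
        rw [← QuotientGroup.eq_one_iff, ← QuotientGroup.mk'_apply, map_commutatorElement,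
          commutatorElement_eq_one_iff_mul_comm]
        exact congrArg Subtype.val
          (hcomm.is_comm.comm ⟨_, hQS a.2⟩ ⟨_, hQS b.2⟩)
    exact this.index_ne_zero
  refine ⟨?_⟩
  rw [← Subgroup.relIndex_top_right]
  exact Subgroup.relIndex_ne_zero_trans hQR (by
    rw [Subgroup.relIndex_top_right]; exact hQi.index_ne_zero)

theorem HasCongruenceSubgroupProperty.exists_level (hcsp : HasCongruenceSubgroupProperty G)
    {K : Subgroup G} (hK : K.FiniteIndex) : ∃ n, (stab (level d n)).subgroupOf G ≤ K := by
  have hKG : (K.map G.subtype).subgroupOf G = K :=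
    Subgroup.comap_map_eq_self_of_injective G.subtype_injective K
  obtain ⟨n, hn⟩ := hcsp (K.map G.subtype) (Subgroup.map_subtype_le K)
    (Subgroup.isFiniteRelIndex_iff_finiteIndex.2 (by rwa [hKG]))
  refine ⟨n, fun x hx => ?_⟩
  rw [← hKG]
  exact hn ⟨x.2, hx⟩

/-- If `Φ_F(G)` has finite index, then all congruence quotients of `G` are nilpotent. -/
theorem isNilpotent_quotient_stab_level (hd : 0 < d) (hssr : IsStronglySelfReplicating G)
    (hcsp : HasCongruenceSubgroupProperty G) (hPhi : (frattiniFin G).FiniteIndex) (n : ℕ) :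
    Group.IsNilpotent (G ⧸ (stab (level d n)).subgroupOf G) := by
  obtain ⟨m, hm⟩ := hcsp.exists_level hPhi
  obtain ⟨v, hv⟩ : ∃ v, v ∈ level d m := exists_prefix_length (v := []) hd (Nat.zero_le m)
  set St : ℕ → Subgroup G := fun n => (stab (level d n)).subgroupOf G
  have hSt : ∀ n, (St n).FiniteIndex := fun n => inferInstanceAs
    ((stab (level d n)).subgroupOf G).FiniteIndex
  have hStn : ∀ n, (St n).Normal := fun n => inferInstanceAs
    ((stab (level d n)).subgroupOf G).Normal
  let f : St m →* G ⧸ St (m + n) := (QuotientGroup.mk' (St (m + n))).comp (St m).subtype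
  have hf : f.range ≤ frattini (G ⧸ St (m + n)) := by
    -- A maximal subgroup of the finite quotient pulls back to a maximal subgroup of finite index in
    -- G, which contains Φ_F(G) and hence Stab(m).
    rintro _ ⟨x, rfl⟩
    refine Subgroup.mem_iInf.2 fun M => Subgroup.mem_iInf.2 fun hM => ?_
    have hsurj := QuotientGroup.mk'_surjective (St (m + n))
    have hx := Subgroup.mem_sInf.1 (hm x.2) (M.comap (QuotientGroup.mk' (St (m + n)))) ⟨?_, ⟨?_⟩⟩
    · exact hx
    · exact Subgroup.isCoatom_comap_of_surjective hsurj hM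
    · rw [Subgroup.index_comap_of_surjective _ hsurj]
      exact Subgroup.index_ne_zero_of_finite
  have hnil : Group.IsNilpotent f.range := by
    have := frattini_nilpotent (G := G ⧸ St (m + n))
    exact Group.nilpotent_of_mulEquiv (Subgroup.subgroupOfEquivOfLe hf)
  have hnil' : Group.IsNilpotent (St m ⧸ f.ker) :=
    Group.nilpotent_of_mulEquiv (QuotientGroup.quotientKerEquivRange f).symm
  -- The section at v of level m maps Stab(m) onto G and Stab(m + n) into Stab(n), so G/Stab(n) is a
  -- quotient of the nilpotent image of Stab(m).
  let ψ : St m →* G ⧸ St n := (QuotientGroup.mk' (St n)).comp (levelSec hssr hv)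
  have hψ : f.ker ≤ ψ.ker := by
    intro x hx
    have hx' : x.1 ∈ St (m + n) := (QuotientGroup.eq_one_iff _).1 hx
    refine (QuotientGroup.eq_one_iff _).2 fun w hw => ?_
    have h := hx' (v ++ w) (by
      rw [← show v.length = m from hv, ← show w.length = n from hw]
      exact List.length_append)
    refine sectionFun_eq ?_
    have h' : x.1.1 v = v := x.2 v hv
    rw [h']
    exact h
  refine Group.nilpotent_of_surjective (QuotientGroup.lift f.ker ψ hψ) ?_
  refine QuotientGroup.lift_surjective_of_surjective _ _ ?_ _
  exact (QuotientGroup.mk'_surjective _).comp (levelSec_surjective hssr hv)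

end RegTree

/-! ### Dense subgroups of direct powers. -/

namespace RegTree

variable {d : ℕ} {G : Subgroup (TreeAut d)} {ι : Type*}

/-- Let `E'` be a subgroup of finite index in `P ≤ G` that is dense in `Stab_G(level m)`, where `m`
is at least the depth of a transversal provided for `P` by the subgroup induction property. Then
`E'` has full sections at level `m`. -/
theorem secImage_eq_of_denseIn (hd : 2 ≤ d) (hssr : IsStronglySelfReplicating G)
    (hbranch : IsBranch G) {P : Subgroup (TreeAut d)} {X : Set (Vertex d)} (hX : IsTransversal X)
    (hXP : ∀ v ∈ X, secImage v (P ⊓ stab X) = ⊥ ∨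
      (secImage v (P ⊓ stab X)).IsFiniteRelIndex (secImage v (G ⊓ stab {v})))
    {m : ℕ} (hm : ∀ v ∈ X, v.length ≤ m) {E : Subgroup (TreeAut d)} (hEP : E ≤ P)
    (hEi : E.relIndex P ≠ 0) (hE : DenseIn E (G ⊓ stab (level d m))) {u : Vertex d}
    (hu : u ∈ level d m) : secImage u E = G := by
  have hd0 : 0 < d := by omega
  obtain ⟨v, hv, hvu⟩ : ∃ v ∈ X, v <+: u := by
    obtain ⟨v, hv, h | h⟩ := hX.exists_prefix_or_prefix hd0 u
    · exact ⟨v, hv, h⟩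
    · refine ⟨v, hv, ?_⟩
      rw [h.eq_of_length (le_antisymm h.length_le ((hm v hv).trans (Eq.symm hu).le))]
  obtain ⟨w, rfl⟩ := hvu
  have hEX : E ≤ P ⊓ stab X := le_inf hEP fun g hg x hx =>
    apply_eq_of_mem_stab_level hd0 (hE.1 hg).2 (hm x hx)
  have hvstab : G ⊓ stab (level d m) ≤ G ⊓ stab {v} := by
    refine inf_le_inf_left G fun g hg x hx => ?_
    rw [Set.mem_singleton_iff.1 hx]
    exact apply_eq_of_mem_stab_level hd0 hg (hm v hv)
  have hfull : secImage (v ++ w) (G ⊓ stab (level d m)) = G := hssr.secImage_eq m _ hu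
  have hrel : (secImage v E).relIndex (secImage v (P ⊓ stab X)) ≠ 0 :=
    relIndex_secImage_ne_zero v fun h0 =>
      hEi (Subgroup.relIndex_eq_zero_of_le_right inf_le_left h0)
  rcases hXP v hv with hbot | hfin
  · exfalso
    -- A trivial section at v would make the trivial subgroup dense in G, contradicting transitivity
    -- on level 1, which has at least two vertices.
    have hvE : secImage v E = ⊥ := le_bot_iff.1 (hbot ▸ secImage_mono v hEX)
    have hdense := hE.secImage (v := v ++ w)
      (inf_le_right.trans (stab_level_le_stab_singleton hu))
    rw [hfull, secImage_append, hvE] at hdense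
    have h1 := hdense.2 (G ⊓ stab (level d 1)) inf_le_left
      (by
        rw [Subgroup.inf_relIndex_left]
        exact fun h0 => (finiteIndex_stab_level 1).index_ne_zero
          (Subgroup.index_eq_zero_of_relIndex_eq_zero h0))
      (by
        rintro _ h
        obtain ⟨g, hg, -, rfl⟩ := mem_secImage.1 h
        rw [Subgroup.mem_bot.1 hg]
        have : sec w (1 : TreeAut d) = 1 := map_one (secHom w)
        rw [this]
        exact Subgroup.one_mem _)
    obtain ⟨g, hg, hgx⟩ := hbranch.transitive 1 [⟨0, by omega⟩] rfl [⟨1, by omega⟩] rfl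
    rw [← h1] at hg
    rw [hg.2 _ rfl] at hgx
    simp at hgx
  · have hS : secImage v E = secImage v (G ⊓ stab (level d m)) := by
      refine (hE.secImage (hvstab.trans inf_le_right)).eq_of_relIndex_ne_zero fun h0 => ?_
      exact Subgroup.relIndex_ne_zero_trans hrel hfin.relIndex_ne_zero
        (Subgroup.relIndex_eq_zero_of_le_right (secImage_mono v hvstab) h0)
    rw [secImage_append, hS, ← secImage_append, hfull]

/-- The direct power of the stabilizer of level `n` in `G`. -/
def levelPow (G : Subgroup (TreeAut d)) (ι : Type*) (n : ℕ) : Subgroup (ι → G) :=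
  Subgroup.pi Set.univ fun _ => (stab (level d n)).subgroupOf G

theorem mem_levelPow {n : ℕ} {x : ι → G} :
    x ∈ levelPow G ι n ↔ ∀ i, (x i).1 ∈ stab (level d n) := by
  simp [levelPow, Subgroup.mem_pi, Subgroup.mem_subgroupOf]

theorem levelPow_anti (hd : 0 < d) {m n : ℕ} (hmn : m ≤ n) :
    levelPow G ι n ≤ levelPow G ι m := fun _ hx =>
  mem_levelPow.2 fun i => stab_level_anti hd hmn (mem_levelPow.1 hx i)

theorem mulSingle_mem_levelPow [DecidableEq ι] {n : ℕ} {x : G} (hx : x.1 ∈ stab (level d n))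
    (i : ι) : Pi.mulSingle i x ∈ levelPow G ι n := by
  refine mem_levelPow.2 fun j => ?_
  rcases eq_or_ne j i with rfl | h
  · rwa [Pi.mulSingle_eq_same]
  · rw [Pi.mulSingle_eq_of_ne h]
    exact Subgroup.one_mem _

/-- The homomorphism from `G ^ ι` to the congruence quotient of level `n`. -/
def toLevelQuotient (G : Subgroup (TreeAut d)) (ι : Type*) (n : ℕ) :
    (ι → G) →* (ι → G ⧸ (stab (level d n)).subgroupOf G) :=
  MonoidHom.pi fun i => (QuotientGroup.mk' _).comp (Pi.evalMonoidHom _ i)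

theorem ker_toLevelQuotient (n : ℕ) : (toLevelQuotient G ι n).ker = levelPow G ι n := by
  ext x
  rw [MonoidHom.mem_ker, mem_levelPow, funext_iff]
  exact forall_congr' fun i => QuotientGroup.eq_one_iff (x i)

instance finiteIndex_levelPow [Finite ι] (n : ℕ) : (levelPow G ι n).FiniteIndex := by
  rw [← ker_toLevelQuotient]
  infer_instance

theorem HasCongruenceSubgroupProperty.exists_levelPow_le (hd : 0 < d)
    (hcsp : HasCongruenceSubgroupProperty G) [Finite ι] {F : Subgroup (ι → G)}
    (hF : F.FiniteIndex) : ∃ n, levelPow G ι n ≤ F := by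
  classical
  have := Fintype.ofFinite ι
  have h : ∀ i, ∃ n, (stab (level d n)).subgroupOf G ≤
      F.comap (MonoidHom.mulSingle (fun _ : ι => G) i) := fun i =>
    hcsp.exists_level ⟨by
      rw [Subgroup.index_comap]
      exact fun h0 => hF.index_ne_zero (Subgroup.index_eq_zero_of_relIndex_eq_zero h0)⟩
  choose n hn using h
  refine ⟨Finset.univ.sup n, fun x hx => Subgroup.pi_mem_of_mulSingle_mem x fun i => hn i ?_⟩
  exact stab_level_anti hd (Finset.le_sup (Finset.mem_univ i)) (mem_levelPow.1 hx i)

/-- Finitely generated subgroups of `G ^ ι` that are dense in a subgroup of finite index have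
finite index. -/
theorem eq_of_fg_of_denseIn (hd : 2 ≤ d) (hfg : Group.FG G) (hssr : IsStronglySelfReplicating G)
    (hbranch : IsBranch G) (hsip : HasSubgroupInductionProperty G)
    (hcsp : HasCongruenceSubgroupProperty G) [Finite ι] {J E : Subgroup (ι → G)}
    (hJ : J.FiniteIndex) (hEfg : E.FG) (hE : DenseIn E J) : E = J := by
  classical
  have := Fintype.ofFinite ι
  have hd0 : 0 < d := by omega
  have htor : ∀ g : G, IsOfFinOrder g := fun g =>
    G.subtype_injective.isOfFinOrder_iff.1 (isOfFinOrder_of_mem hd0 hssr hbranch hsip g.2)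
  let p : ι → (ι → G) →* TreeAut d := fun i => G.subtype.comp (Pi.evalMonoidHom _ i)
  have hpG : ∀ i, E.map (p i) ≤ G := by
    rintro i _ ⟨x, -, rfl⟩
    exact (x i).2
  choose X hX hXP using fun i => hsip (E.map (p i)) (hpG i) (Subgroup.fg_map (p i) hEfg)
  choose b hb using fun i => ((hX i).finite hd0).image List.length |>.bddAbove
  obtain ⟨n, hn⟩ := hcsp.exists_levelPow_le hd0 hJ
  -- Level m is deep enough both for Stab(m)^ι ≤ J and to lie below all the transversals.
  set m := max n (Finset.univ.sup b) with hm
  set A := levelPow G ι m with hA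
  have hAJ : A ≤ J := (levelPow_anti hd0 (le_max_left _ _)).trans hn
  have hAi : A.relIndex J ≠ 0 := fun h0 =>
    (finiteIndex_levelPow m).index_ne_zero (Subgroup.index_eq_zero_of_relIndex_eq_zero h0)
  have hEA : DenseIn (E ⊓ A) A := hE.inf hAJ hAi
  have hpA : ∀ i, A.map (p i) = G ⊓ stab (level d m) := by
    intro i
    refine le_antisymm ?_ fun g hg => ?_
    · rintro _ ⟨x, hx, rfl⟩
      exact ⟨(x i).2, mem_levelPow.1 hx i⟩
    · refine ⟨Pi.mulSingle i ⟨g, hg.1⟩, mulSingle_mem_levelPow hg.2 i, ?_⟩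
      simp [p]
  have hsec : ∀ i, ∀ u ∈ level d m, secImage u ((E ⊓ A).map (p i)) = G := by
    intro i u hu
    refine secImage_eq_of_denseIn hd hssr hbranch (hX i) (hXP i) (fun v hv => ?_)
      (Subgroup.map_mono inf_le_left) ?_ (hpA i ▸ hEA.map (p i)) hu
    · exact (hb i ⟨v, hv, rfl⟩).trans
        ((Finset.le_sup (f := b) (Finset.mem_univ i)).trans (le_max_right _ _))
    · refine Subgroup.relIndex_map_ne_zero _ ?_
      rw [Subgroup.inf_relIndex_left]
      exact fun h0 =>
        (finiteIndex_levelPow m).index_ne_zero (Subgroup.index_eq_zero_of_relIndex_eq_zero h0)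
  let π₀ : ι → A →* (stab (level d m)).subgroupOf G := fun i =>
    ((Pi.evalMonoidHom _ i).comp A.subtype).codRestrict _ fun a => mem_levelPow.1 a.2 i
  -- The sections at the vertices of level m, in every coordinate, embed A in a power of G.
  let π : ι × level d m → A →* G := fun q => (levelSec hssr q.2.2).comp (π₀ q.1)
  have hval : ∀ q a, (π q a : TreeAut d) = sec q.2.1 (a.1 q.1).1 := fun _ _ => rfl
  have hfinl : Finite (level d m) := finite_level m
  have hK : (E ⊓ A).subgroupOf A = ⊤ := by
    have hdense := hEA.subgroupOf (le_refl A)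
    rw [Subgroup.subgroupOf_self] at hdense
    have honto : ∀ q, ((E ⊓ A).subgroupOf A).map (π q) = ⊤ := by
      rintro ⟨i, u, hu⟩
      refine eq_top_iff.2 fun g _ => ?_
      have hg : (g : TreeAut d) ∈ secImage u ((E ⊓ A).map (p i)) := (hsec i u hu).symm ▸ g.2
      obtain ⟨_, ⟨x, hx, rfl⟩, -, hxg⟩ := mem_secImage.1 hg
      exact ⟨⟨x, hx.2⟩, hx, Subtype.ext hxg⟩
    refine eq_top_of_denseIn_of_map_eq_top π (fun q => ?_)
      (fun R hR hne => hbranch.finiteIndex_of_normal htor hR hne) (fun x hx => ?_)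
      (fun a ha => ?_) ?_ hdense honto
    · intro g
      have hg : g ∈ ((E ⊓ A).subgroupOf A).map (π q) := honto q ▸ Subgroup.mem_top g
      obtain ⟨a, -, ha⟩ := hg
      exact ⟨a, ha⟩
    · obtain ⟨v, hv⟩ : ∃ v, x.1 v ≠ v := by
        by_contra! h
        exact hx (Subtype.ext (RelIso.ext h))
      exact ⟨(stab (level d v.length)).subgroupOf G, inferInstance, inferInstance,
        fun h => hv (h v rfl)⟩
    · refine Subtype.ext (funext fun i => Subtype.ext ?_)
      refine eq_one_of_sec_eq_one (mem_levelPow.1 a.2 i)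
        (exists_level_prefix_or_prefix hd0 m) fun u hu => ?_
      exact congrArg Subtype.val (ha ⟨i, u, hu⟩)
    · rintro ⟨i, u, hu⟩
      -- A nontrivial element of Rist(u), placed in coordinate i, has trivial image in every factor
      -- except (i, u).
      obtain ⟨r, hrG, hr, hr1⟩ := hbranch.exists_mem_rist_ne_one (C := G)
        (by rw [Subgroup.relIndex_self]; exact one_ne_zero) u
      refine ⟨⟨Pi.mulSingle i ⟨r, hrG⟩,
        mulSingle_mem_levelPow (rist_le_stab_level hu hr) i⟩, fun h => ?_, ?_⟩
      · have h' := congrArg Subtype.val h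
        rw [hval] at h'
        simp only [Pi.mulSingle_eq_same] at h'
        exact sec_ne_one_of_mem_rist hr hr1 h'
      · rintro ⟨j, w, hw⟩ hne
        refine Subtype.ext ?_
        rw [hval]
        rcases eq_or_ne j i with rfl | hji
        · simp only [Pi.mulSingle_eq_same]
          refine sec_eq_one_of_mem_rist (Eq.trans hu (Eq.symm hw)) (fun h => hne ?_) hr
          subst h
          rfl
        · simp only [Pi.mulSingle_eq_of_ne hji]
          exact map_one (secHom w)
  have hAE : A ≤ E := (Subgroup.subgroupOf_eq_top.1 hK).trans inf_le_left
  exact hE.eq_of_relIndex_ne_zero fun h0 => hAi (Subgroup.relIndex_eq_zero_of_le_left hAE h0)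

/-- Subgroups of finite index of `G ^ ι` have no proper subgroups that are dense in the profinite
topology. -/
theorem eq_of_denseIn (hd : 2 ≤ d) (hfg : Group.FG G) (hssr : IsStronglySelfReplicating G)
    (hbranch : IsBranch G) (hsip : HasSubgroupInductionProperty G)
    (hcsp : HasCongruenceSubgroupProperty G) (hPhi : frattiniFin G ≠ ⊥) [Finite ι]
    {J D : Subgroup (ι → G)} (hJ : J.FiniteIndex) (hD : DenseIn D J) : D = J := by
  have hd0 : 0 < d := by omega
  have htor : ∀ g : G, IsOfFinOrder g := fun g =>
    G.subtype_injective.isOfFinOrder_iff.1 (isOfFinOrder_of_mem hd0 hssr hbranch hsip g.2)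
  have hPhi' : (frattiniFin G).FiniteIndex :=
    hbranch.finiteIndex_of_normal htor (frattiniFin_normal G) hPhi
  have htorJ : ∀ g : J, IsOfFinOrder g := fun g => by
    have := Fintype.ofFinite ι
    refine J.subtype_injective.isOfFinOrder_iff.1 (isOfFinOrder_iff_pow_eq_one.2
      ⟨∏ i, orderOf (g.1 i), Finset.prod_pos fun i _ => (htor _).orderOf_pos, funext fun i => ?_⟩)
    exact orderOf_dvd_iff_pow_eq_one.1 (Finset.dvd_prod_of_mem _ (Finset.mem_univ i))
  have hJfg : Group.FG J := Subgroup.fg_of_index_ne_zero J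
  have hDJ := hD.subgroupOf (le_refl J)
  rw [Subgroup.subgroupOf_self] at hDJ
  obtain ⟨E, hED, hEfg, hE⟩ := exists_fg_denseIn_top
    (finiteIndex_of_commutator_le htorJ le_rfl) (fun F hF => by
      have hFJ : (F.map J.subtype).FiniteIndex := ⟨by
        rw [Subgroup.index_map_subtype]
        exact mul_ne_zero hF.index_ne_zero hJ.index_ne_zero⟩
      obtain ⟨n, hn⟩ := hcsp.exists_levelPow_le hd0 hFJ
      -- The quotient of J by the kernel of f embeds in a finite power of a nilpotent congruence
      -- quotient.
      let f := (toLevelQuotient G ι n).comp J.subtype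
      have hnil := isNilpotent_quotient_stab_level hd0 hssr hcsp hPhi' n
      refine ⟨f.ker, fun x hx => ?_, inferInstance, inferInstance,
        Group.nilpotent_of_mulEquiv (QuotientGroup.quotientKerEquivRange f).symm⟩
      have hx' : (x : ι → G) ∈ levelPow G ι n := by
        rw [← ker_toLevelQuotient]
        exact hx
      obtain ⟨y, hy, hyx⟩ := hn hx'
      rwa [← Subtype.ext hyx]) hDJ
  have hE' := hE.map J.subtype
  rw [← MonoidHom.range_eq_map, Subgroup.range_subtype] at hE'
  have hEJ := eq_of_fg_of_denseIn hd hfg hssr hbranch hsip hcsp hJ (Subgroup.fg_map J.subtype hEfg) hE'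
  refine le_antisymm hD.1 ?_
  rw [← hEJ, Subgroup.map_le_iff_le_comap]
  exact hED

end RegTree

/-! ### Transfer along commensurability. -/

theorem mainTheorem4 {d : ℕ} (hd : 2 ≤ d) (G : Subgroup (RegTree.TreeAut d)) (hfg : G.FG)
    (hssr : RegTree.IsStronglySelfReplicating G) (hbranch : RegTree.IsBranch G)
    (hsip : RegTree.HasSubgroupInductionProperty G)
    (hcsp : RegTree.HasCongruenceSubgroupProperty G)
    (hPhi : frattiniFin G ≠ ⊥)
    (k : ℕ) {H : Type*} [Group H] (hcomm : AreCommensurable H (Fin k → G))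
    (M : Subgroup H) (hM : IsCoatom M) : M.FiniteIndex := by
  by_contra hMi
  obtain ⟨K, J, hK, hJ, ⟨e⟩⟩ := hcomm
  have hMK := ((hM.denseIn_top hMi).inf (A := K) le_top (by
    rw [Subgroup.relIndex_top_right]; exact hK.index_ne_zero)).subgroupOf le_rfl
  rw [Subgroup.subgroupOf_self] at hMK
  have hD := hMK.map (J.subtype.comp e.toMonoidHom)
  have hrange : (⊤ : Subgroup K).map (J.subtype.comp e.toMonoidHom) = J := by
    rw [← Subgroup.map_map, Subgroup.map_top_of_surjective _ e.surjective,
      ← MonoidHom.range_eq_map, Subgroup.range_subtype]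
  rw [hrange] at hD
  have hEq := RegTree.eq_of_denseIn hd ((Group.fg_iff_subgroup_fg G).2 hfg) hssr hbranch hsip hcsp
    hPhi hJ hD
  -- Injectivity pulls the equality back to K: then K ≤ M, so M has finite index after all.
  have htop := Subgroup.map_injective (f := J.subtype.comp e.toMonoidHom)
    (J.subtype_injective.comp e.injective) (hEq.trans hrange.symm)
  have hle : K ≤ M := (Subgroup.subgroupOf_eq_top.1 htop).trans inf_le_left
  exact hMi (Subgroup.finiteIndex_of_le hle)
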